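/- Fix $n\in\mathbb N=\{1,2,\dots\}$. Coupons arrive one by one at times $1,2,3,\dots$; their types are independent and uniformly distributed on a set of $n$ types. Collectors are labelled $0,1,2,\dots$ and all start with empty albums. Each arriving coupon is put in the album of the collector with the smallest label whose album does not yet contain a coupon of this type. For $r\in\mathbb N_0=\{0,1,2,\dots\}$, let $T_r^{(n)}$ be the time at which the album of collector $r$ first contains all $n$ types. For $r_1,r_2\in\mathbb N_0$ with $r_2>r_1$, let $\Delta_{r_1,r_2}^{(n)}=T_{r_2}^{(n)}-T_{r_1}^{(n)}$, and let $L_{r_1,r_2}$ be a logistic random variable with distribution function \[\mathbb P\{L_{r_1,r_2}<x\}=\frac{r_2!}{r_2!+r_1!\,\mathrm e^{-x}},\qquad x\in\mathbb R.\] Then \[\frac{\Delta_{r_1,r_2}^{(n)}}{n}-(r_2-r_1)\ln\ln n\ \xrightarrow{d}\ L_{r_1,r_2}\qquad\text{as }n\to\infty,\] where $\xrightarrow{d}$ denotes convergence in distribution. -/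

import Mathlib

open MeasureTheory ProbabilityTheory Filter

/-- The albums of the collectors. The coupon `c t` is the `(t + 1)`-st to arrive, and
`album c t r` is the set of coupon types in the album of the collector labelled `r` after `t`
arrivals. All the albums are empty at first. An arriving coupon goes down the line
`0, 1, 2, …`: it reaches collector `r` when every collector `s < r` already has its type, and he
puts it in his album unless he has its type as well. -/
def album {α : Type*} (c : ℕ → α) : ℕ → ℕ → Set α
  | 0, _ => ∅
  | t + 1, r => {i | i ∈ album c t r ∨ (c t = i ∧ ∀ s < r, i ∈ album c t s)}

/-- The time at which collector `r` completes his collection: the least number of arrivals after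
which his album contains every type. (It is `0` by convention if this never happens, which for
uniform independent coupons is an event of probability zero.) -/
noncomputable def completionTime {α : Type*} (c : ℕ → α) (r : ℕ) : ℕ :=
  sInf {t | album c t r = Set.univ}

/-- The inter-completion time `T_{r₂} - T_{r₁}`. -/
noncomputable def interCompletionTime {α : Type*} (c : ℕ → α) (r₁ r₂ : ℕ) : ℝ :=
  (completionTime c r₂ : ℝ) - (completionTime c r₁ : ℝ)

/-!
The album of collector `r` contains a type iff at least `r + 1` coupons of that type have arrived.
If coupons arrive in two consecutive blocks of independent Poisson lengths, the numbers of coupons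
of the different types become independent. At the times `n (log n + r₁ log log n + x)` and
`n (log n + r₂ log log n + y)` each of the `n` types is missing from one of the two albums with
probability about `(exp (-x) / r₁! + exp (-y) / r₂!) / n`, being missing from both having
negligible probability. So the completion times, normalized by their scales, converge jointly to
independent Gumbel variables. The fluctuations of the Poisson clock are of order `√(n log n)`,
hence negligible compared to `n`, and a complete album stays complete, so that the same limit holds
for the original arrivals. Finally, the difference of two independent Gumbel variables is logistic.
-/

open scoped Nat NNReal ENNReal Topology

section Combinatorics

variable {α : Type*} [DecidableEq α]

/-- The number of coupons of type `i` among the first `t` arrivals `c 0, …, c (t - 1)`. -/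
def couponCount (c : ℕ → α) (t : ℕ) (i : α) : ℕ :=
  Nat.count (fun k => c k = i) t

theorem couponCount_zero (c : ℕ → α) : couponCount c 0 = 0 :=
  rfl

theorem couponCount_succ (c : ℕ → α) (t : ℕ) :
    couponCount c (t + 1) = couponCount c t + Pi.single (c t) 1 := by
  ext i
  simp [couponCount, Nat.count_succ, Pi.single_apply, eq_comm]

theorem couponCount_add (c : ℕ → α) (s t : ℕ) :
    couponCount c (s + t) = couponCount c s + couponCount (fun k => c (s + k)) t :=
  funext fun _ => Nat.count_add _ _ _

theorem couponCount_eq_sum (c : ℕ → α) (t : ℕ) :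
    couponCount c t = ∑ k ∈ Finset.range t, Pi.single (c k) 1 := by
  induction t with
  | zero => rfl
  | succ t ih => rw [couponCount_succ, ih, Finset.sum_range_succ]

theorem couponCount_mono (c : ℕ → α) : Monotone (couponCount c) :=
  fun _ _ hst _ => Nat.count_monotone _ hst

theorem sum_couponCount [Fintype α] (c : ℕ → α) (t : ℕ) : ∑ i, couponCount c t i = t := by
  induction t with
  | zero => simp [couponCount_zero]
  | succ t ih => simp [couponCount_succ, Finset.sum_add_distrib, ih]

theorem mem_album_iff (c : ℕ → α) (t r : ℕ) (i : α) :
    i ∈ album c t r ↔ r < couponCount c t i := by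
  induction t generalizing r with
  | zero => simp [album, couponCount_zero]
  | succ t ih =>
    have all_lt_iff : (∀ s < r, s < couponCount c t i) ↔ r ≤ couponCount c t i :=
      ⟨fun h => not_lt.1 fun hlt => lt_irrefl _ (h _ hlt), fun h _ hs => hs.trans_le h⟩
    simp only [album, Set.mem_ofPred_eq, ih, all_lt_iff, couponCount_succ, Pi.add_apply,
      Pi.single_apply]
    grind

theorem album_eq_univ_iff (c : ℕ → α) (t r : ℕ) :
    album c t r = Set.univ ↔ ∀ i, r < couponCount c t i := by
  simp only [Set.eq_univ_iff_forall, mem_album_iff]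

theorem exists_lt_couponCount {c : ℕ → α} {i : α} (h : ∃ᶠ k in atTop, c k = i) (r : ℕ) :
    ∃ t, r < couponCount c t i :=
  ⟨_, Nat.lt_of_succ_le
    (Nat.count_nth_succ_of_infinite (Nat.frequently_atTop_iff_infinite.1 h) r).ge⟩

theorem exists_album_eq_univ {α : Type*} [Finite α] {c : ℕ → α}
    (h : ∀ i, ∃ᶠ k in atTop, c k = i) (r : ℕ) : ∃ t, album c t r = Set.univ := by
  classical
  choose t ht using fun i => exists_lt_couponCount (h i) r
  obtain ⟨m, hm⟩ := (Set.finite_range t).bddAbove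
  exact ⟨m, (album_eq_univ_iff c m r).2 fun i =>
    (ht i).trans_le (couponCount_mono c (hm ⟨i, rfl⟩) i)⟩

theorem completionTime_le_iff {c : ℕ → α} {r : ℕ} (h : ∃ t, album c t r = Set.univ) (m : ℕ) :
    completionTime c r ≤ m ↔ ∀ i, r < couponCount c m i := by
  refine ⟨fun hm i => ?_, fun hm => Nat.sInf_le ((album_eq_univ_iff c m r).2 hm)⟩
  exact ((album_eq_univ_iff c _ r).1 (Nat.sInf_mem h) i).trans_le (couponCount_mono c hm i)

end Combinatorics

section CouponLaw

/-- `C` is a sequence of independent coupons under `P`, each of which is of type `i` with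
probability `p i`. -/
structure IsCouponSequence {Ω α : Type*} [MeasurableSpace Ω] [MeasurableSpace α]
    (C : ℕ → Ω → α) (p : α → ℝ≥0) (P : Measure Ω) : Prop where
  measurable (k : ℕ) : Measurable (C k)
  iIndepFun : iIndepFun C P
  measureReal_eq (k : ℕ) (i : α) : P.real {ω | C k ω = i} = p i

variable {Ω α : Type*} [MeasurableSpace Ω] [MeasurableSpace α] {P : Measure Ω}
  {C : ℕ → Ω → α} {p : α → ℝ≥0}

theorem IsCouponSequence.shift (h : IsCouponSequence C p P) (s : ℕ) :
    IsCouponSequence (fun k => C (s + k)) p P where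
  measurable k := h.measurable (s + k)
  iIndepFun := h.iIndepFun.precomp (add_right_injective s)
  measureReal_eq k := h.measureReal_eq (s + k)

theorem IsCouponSequence.nonempty (h : IsCouponSequence C p P) : Nonempty α :=
  have := h.iIndepFun.isProbabilityMeasure
  (nonempty_of_isProbabilityMeasure P).map (C 0)

section Countable

variable [Countable α] [MeasurableSingletonClass α] [DecidableEq α]

theorem measurable_couponCount (hC : ∀ k, Measurable (C k)) (t : ℕ) :
    Measurable fun ω => couponCount (fun k => C k ω) t := by
  simp only [couponCount_eq_sum]
  exact Finset.measurable_sum _ fun k _ =>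
    (measurable_of_countable fun i => Pi.single i 1).comp (hC k)

theorem IsCouponSequence.indepFun_couponCount_eval (h : IsCouponSequence C p P) (t : ℕ) :
    IndepFun (fun ω => couponCount (fun k => C k ω) t) (C t) P := by
  have hdisj : Disjoint (Finset.range t) {t} := by simp
  convert (h.iIndepFun.indepFun_finset _ _ hdisj h.measurable).comp
    (measurable_of_countable fun v : Finset.range t → α => ∑ k, (Pi.single (v k) 1 : α → ℕ))
    (measurable_pi_apply ⟨t, Finset.mem_singleton_self t⟩) using 2 with ω
  · exact (couponCount_eq_sum _ t).trans (Finset.sum_coe_sort _ _).symm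
  · rfl

theorem IsCouponSequence.indepFun_couponCount_shift (h : IsCouponSequence C p P) (s t : ℕ) :
    IndepFun (fun ω => couponCount (fun k => C k ω) s)
      (fun ω => couponCount (fun k => C (s + k) ω) t) P := by
  have hdisj : Disjoint (Finset.range s) (Finset.Ico s (s + t)) := by
    rw [Finset.range_eq_Ico]
    exact Finset.Ico_disjoint_Ico_consecutive 0 s (s + t)
  convert (h.iIndepFun.indepFun_finset _ _ hdisj h.measurable).comp
    (measurable_of_countable fun v : Finset.range s → α => ∑ k, (Pi.single (v k) 1 : α → ℕ))
    (measurable_of_countable fun v : Finset.Ico s (s + t) → α =>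
      ∑ k, (Pi.single (v k) 1 : α → ℕ)) using 2 with ω ω
  · exact (couponCount_eq_sum _ s).trans (Finset.sum_coe_sort _ _).symm
  · calc couponCount (fun k => C (s + k) ω) t
        = ∑ k ∈ Finset.range t, Pi.single (C (s + k) ω) 1 := couponCount_eq_sum _ t
      _ = ∑ k ∈ Finset.Ico s (s + t), Pi.single (C k ω) 1 := by
        rw [Finset.sum_Ico_eq_sum_range, Nat.add_sub_cancel_left]
      _ = ∑ k : Finset.Ico s (s + t), Pi.single (C k ω) 1 := (Finset.sum_coe_sort _ _).symm

/-- The numbers of coupons of each type in two consecutive blocks of arrivals, the first of length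
`m.1` and the second of length `m.2`. -/
def blockCounts (c : ℕ → α) (m : ℕ × ℕ) (i : α) : ℕ × ℕ :=
  (couponCount c m.1 i, couponCount (fun k => c (m.1 + k)) m.2 i)

theorem measurable_blockCounts (hC : ∀ k, Measurable (C k)) :
    Measurable fun q : Ω × ℕ × ℕ => blockCounts (fun k => C k q.1) q.2 := by
  refine measurable_from_prod_countable_left fun m => measurable_pi_lambda _ fun i => ?_
  exact ((measurable_pi_apply i).comp (measurable_couponCount hC m.1)).prodMk
    ((measurable_pi_apply i).comp (measurable_couponCount (fun k => hC (m.1 + k)) m.2))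

end Countable

variable [Fintype α] [MeasurableSingletonClass α]

theorem IsCouponSequence.sum_eq_one (h : IsCouponSequence C p P) : ∑ i, p i = 1 := by
  have := h.iIndepFun.isProbabilityMeasure
  have hsum := sum_measureReal_preimage_singleton (μ := P) (f := C 0) Finset.univ
    fun i _ => h.measurable 0 (measurableSet_singleton i)
  rw [Finset.coe_univ, Set.preimage_univ, probReal_univ] at hsum
  rw [← NNReal.coe_inj, NNReal.coe_sum, NNReal.coe_one, ← hsum]
  exact Finset.sum_congr rfl fun i _ => (h.measureReal_eq 0 i).symm

variable [DecidableEq α]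

theorem add_one_mul_prod_pow_div_factorial_add_single {ι K : Type*} [Fintype ι] [DecidableEq ι]
    [Field K] [CharZero K] (p : ι → K) (j : ι → ℕ) (i : ι) :
    (j i + 1) * ∏ l, p l ^ (j + Pi.single i 1 : ι → ℕ) l / ((j + Pi.single i 1 : ι → ℕ) l)! =
      p i * ∏ l, p l ^ j l / (j l)! := by
  have hne : ∀ l ∈ Finset.univ.erase i, (j + Pi.single i 1 : ι → ℕ) l = j l := fun l hl => by
    simp [Finset.ne_of_mem_erase hl]
  have hi : (j + Pi.single i 1 : ι → ℕ) i = j i + 1 := by simp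
  have hji : (j i + 1 : K) ≠ 0 := by exact_mod_cast (j i).succ_ne_zero
  rw [← Finset.mul_prod_erase _ _ (Finset.mem_univ i), ← Finset.mul_prod_erase _ _
    (Finset.mem_univ i), Finset.prod_congr rfl fun l hl => by rw [hne l hl], hi,
    Nat.factorial_succ, Nat.cast_mul, Nat.cast_succ]
  field_simp
  ring

theorem measureReal_inter_preimage_of_indepFun {Ω β γ : Type*} [MeasurableSpace Ω]
    [MeasurableSpace β] [MeasurableSpace γ] {μ : Measure Ω} {f : Ω → β} {g : Ω → γ}
    (h : IndepFun f g μ) {s : Set β} {t : Set γ} (hs : MeasurableSet s) (ht : MeasurableSet t) :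
    μ.real (f ⁻¹' s ∩ g ⁻¹' t) = μ.real (f ⁻¹' s) * μ.real (g ⁻¹' t) := by
  simp only [measureReal_def, h.measure_inter_preimage_eq_mul s t hs ht, ENNReal.toReal_mul]

theorem IsCouponSequence.measureReal_couponCount_succ_eq (h : IsCouponSequence C p P) (t : ℕ)
    (j : α → ℕ) :
    P.real {ω | couponCount (fun k => C k ω) (t + 1) = j} =
      ∑ i, P.real {ω | couponCount (fun k => C k ω) t + Pi.single i 1 = j} * p i := by
  have := h.iIndepFun.isProbabilityMeasure
  have hlast : ∀ i, MeasurableSet (C t ⁻¹' {i}) := fun i =>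
    h.measurable t (measurableSet_singleton i)
  have hfiber := sum_measureReal_preimage_singleton
    (μ := P.restrict {ω | couponCount (fun k => C k ω) (t + 1) = j}) Finset.univ
    fun i _ => hlast i
  rw [Finset.coe_univ, Set.preimage_univ, measureReal_restrict_apply_univ] at hfiber
  rw [← hfiber]
  refine Finset.sum_congr rfl fun i _ => ?_
  have hinter : C t ⁻¹' {i} ∩ {ω | couponCount (fun k => C k ω) (t + 1) = j} =
      {ω | couponCount (fun k => C k ω) t + Pi.single i 1 = j} ∩ C t ⁻¹' {i} := by
    ext ω
    simp only [couponCount_succ, Set.mem_inter_iff, Set.mem_preimage, Set.mem_singleton_iff,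
      Set.mem_ofPred_eq]
    grind
  rw [measureReal_restrict_apply (hlast i), hinter, ← h.measureReal_eq t i]
  have hindep := measureReal_inter_preimage_of_indepFun (h.indepFun_couponCount_eval t)
    (s := {v | v + Pi.single i 1 = j}) MeasurableSet.of_discrete (measurableSet_singleton i)
  rwa [Set.preimage_ofPred_eq] at hindep

theorem exists_add_single_eq {ι : Type*} [DecidableEq ι] {j : ι → ℕ} {i : ι} (hi : j i ≠ 0) :
    ∃ j' : ι → ℕ, j' + Pi.single i 1 = j :=
  ⟨j - Pi.single i 1, tsub_add_cancel_of_le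
    (update_le_iff.2 ⟨Nat.one_le_iff_ne_zero.2 hi, fun _ _ => Nat.zero_le _⟩)⟩

theorem IsCouponSequence.measureReal_couponCount_eq (h : IsCouponSequence C p P) {t : ℕ}
    {j : α → ℕ} (hj : ∑ i, j i = t) :
    P.real {ω | couponCount (fun k => C k ω) t = j} = t ! * ∏ i, (p i : ℝ) ^ j i / (j i)! := by
  induction t generalizing j with
  | zero =>
    have := h.iIndepFun.isProbabilityMeasure
    obtain rfl : j = 0 := funext fun i => Finset.sum_eq_zero_iff.1 hj i (Finset.mem_univ i)
    simp [couponCount_zero]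
  | succ t ih =>
    have hterm : ∀ i, P.real {ω | couponCount (fun k => C k ω) t + Pi.single i 1 = j} * p i =
        j i * (t ! * ∏ l, (p l : ℝ) ^ j l / (j l)!) := by
      intro i
      by_cases hi : j i = 0
      · have hempty : {ω | couponCount (fun k => C k ω) t + Pi.single i 1 = j} = ∅ :=
          Set.eq_empty_of_forall_notMem fun ω (hω : _ = j) => by
            simpa [hi] using congrFun hω i
        simp [hempty, hi]
      · obtain ⟨j', rfl⟩ := exists_add_single_eq hi
        have hj' : ∑ l, j' l = t := by simpa [Finset.sum_add_distrib] using hj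
        have hweight :=
          add_one_mul_prod_pow_div_factorial_add_single (fun l => (p l : ℝ)) j' i
        simp only [add_left_inj, ih hj', Pi.add_apply, Pi.single_eq_same, Nat.cast_succ]
          at hweight ⊢
        linear_combination -(t ! : ℝ) * hweight
    rw [h.measureReal_couponCount_succ_eq t j, Finset.sum_congr rfl fun i _ => hterm i,
      ← Finset.sum_mul, ← Nat.cast_sum, hj, Nat.factorial_succ]
    push_cast
    ring

theorem IsCouponSequence.poissonMeasure_real_mul_measureReal_couponCount
    (h : IsCouponSequence C p P) (a : ℝ≥0) (j : α → ℕ) :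
    (poissonMeasure a).real {∑ i, j i} *
        P.real {ω | couponCount (fun k => C k ω) (∑ i, j i) = j} =
      ∏ i, (poissonMeasure (a * p i)).real {j i} := by
  have hexp : Real.exp (-a) = ∏ i, Real.exp (-(a * p i)) := by
    rw [← Real.exp_sum, Finset.sum_neg_distrib, ← Finset.mul_sum, ← NNReal.coe_sum,
      h.sum_eq_one, NNReal.coe_one, mul_one]
  rw [h.measureReal_couponCount_eq rfl, poissonMeasure_real_singleton, hexp,
    ← Finset.prod_pow_eq_pow_sum]
  simp only [poissonMeasure_real_singleton, NNReal.coe_mul, mul_pow, mul_div_assoc,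
    Finset.prod_mul_distrib]
  field_simp

theorem preimage_blockCounts_singleton {Ω α : Type*} [Fintype α] [DecidableEq α]
    (C : ℕ → Ω → α) (v : α → ℕ × ℕ) :
    (fun q : Ω × ℕ × ℕ => blockCounts (fun k => C k q.1) q.2) ⁻¹' {v} =
      ({ω | couponCount (fun k => C k ω) (∑ i, (v i).1) = fun i => (v i).1} ∩
        {ω | couponCount (fun k => C (∑ i, (v i).1 + k) ω) (∑ i, (v i).2) = fun i => (v i).2}) ×ˢ
      ({∑ i, (v i).1} ×ˢ {∑ i, (v i).2}) := by
  ext ⟨ω, m, l⟩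
  constructor
  · rintro rfl
    simp [blockCounts, sum_couponCount]
  · rintro ⟨⟨h1, h2⟩, rfl, rfl⟩
    exact funext fun i => Prod.ext (congrFun h1 i) (congrFun h2 i)

theorem IsCouponSequence.map_blockCounts (h : IsCouponSequence C p P) (a b : ℝ≥0) :
    (P.prod ((poissonMeasure a).prod (poissonMeasure b))).map
        (fun q => blockCounts (fun k => C k q.1) q.2) =
      Measure.pi fun i => (poissonMeasure (a * p i)).prod (poissonMeasure (b * p i)) := by
  have := h.iIndepFun.isProbabilityMeasure
  refine Measure.ext_of_singleton fun v => ?_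
  rw [← measureReal_eq_measureReal_iff,
    map_measureReal_apply (measurable_blockCounts h.measurable) (measurableSet_singleton v),
    preimage_blockCounts_singleton, measureReal_prod_prod, measureReal_prod_prod]
  have hindep : P.real
      ({ω | couponCount (fun k => C k ω) (∑ i, (v i).1) = fun i => (v i).1} ∩
        {ω | couponCount (fun k => C (∑ i, (v i).1 + k) ω) (∑ i, (v i).2) = fun i => (v i).2}) =
      P.real {ω | couponCount (fun k => C k ω) (∑ i, (v i).1) = fun i => (v i).1} *
        P.real {ω | couponCount (fun k => C (∑ i, (v i).1 + k) ω) (∑ i, (v i).2) =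
          fun i => (v i).2} :=
    measureReal_inter_preimage_of_indepFun (h.indepFun_couponCount_shift _ _)
      (measurableSet_singleton _) (measurableSet_singleton _)
  have hfirst := h.poissonMeasure_real_mul_measureReal_couponCount a fun i => (v i).1
  have hsecond := (h.shift (∑ i, (v i).1)).poissonMeasure_real_mul_measureReal_couponCount b
    fun i => (v i).2
  have hpi : (Measure.pi fun i =>
      (poissonMeasure (a * p i)).prod (poissonMeasure (b * p i))).real {v} =
      (∏ i, (poissonMeasure (a * p i)).real {(v i).1}) *
        ∏ i, (poissonMeasure (b * p i)).real {(v i).2} := by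
    simp only [measureReal_def, Measure.pi_singleton, ENNReal.toReal_prod,
      ← Finset.prod_mul_distrib, ← ENNReal.toReal_mul, ← Measure.prod_prod,
      Set.singleton_prod_singleton]
  rw [hindep, hpi, ← hfirst, ← hsecond]
  ring

end CouponLaw

section Poisson

theorem hasSum_descFactorial_mul_poisson (r : ℝ≥0) (m : ℕ) :
    HasSum (fun k : ℕ => Real.exp (-r) * r ^ k / k ! * k.descFactorial m) ((r : ℝ) ^ m) := by
  rw [← hasSum_nat_add_iff' m, Finset.sum_eq_zero fun k hk => by
    rw [Nat.descFactorial_of_lt (Finset.mem_range.1 hk), Nat.cast_zero, mul_zero], sub_zero]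
  have hshift := (hasSum_one_poissonMeasure r).mul_left ((r : ℝ) ^ m)
  rw [mul_one] at hshift
  refine hshift.congr_fun fun k => ?_
  have hfact : (k ! : ℝ) * (k + m).descFactorial m = (k + m)! := by
    exact_mod_cast Nat.add_sub_cancel k m ▸ Nat.factorial_mul_descFactorial (Nat.le_add_left m k)
  have hdesc : ((k + m).descFactorial m : ℝ) ≠ 0 := by
    rw [Nat.cast_ne_zero, Ne, Nat.descFactorial_eq_zero_iff_lt, not_lt]
    exact Nat.le_add_left m k
  rw [← hfact]
  field_simp
  ring

theorem hasSum_sq_sub_mul_poisson (r : ℝ≥0) :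
    HasSum (fun k : ℕ => Real.exp (-r) * r ^ k / k ! * (k - r) ^ 2) r := by
  convert ((hasSum_descFactorial_mul_poisson r 2).add
    ((hasSum_descFactorial_mul_poisson r 1).mul_left (1 - 2 * (r : ℝ)))).add
    ((hasSum_one_poissonMeasure r).mul_left ((r : ℝ) ^ 2)) using 1
  · ext k
    rw [Nat.cast_descFactorial_two, Nat.descFactorial_one]
    ring
  · ring

theorem poissonMeasure_real_le_abs_sub_le (r : ℝ≥0) {c : ℝ} (hc : 0 < c) :
    (poissonMeasure r).real {k : ℕ | c ≤ |(k : ℝ) - r|} ≤ r / c ^ 2 := by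
  have hint : Integrable (fun k : ℕ => ((k : ℝ) - r) ^ 2) (poissonMeasure r) := by
    rw [integrable_poissonMeasure_iff]
    refine (hasSum_sq_sub_mul_poisson r).summable.congr fun k => ?_
    rw [Real.norm_of_nonneg (sq_nonneg _)]
  have hval : ∫ k : ℕ, ((k : ℝ) - r) ^ 2 ∂poissonMeasure r = r :=
    (hasSum_integral_poissonMeasure hint).unique (hasSum_sq_sub_mul_poisson r)
  have hset : {k : ℕ | c ^ 2 ≤ ((k : ℝ) - r) ^ 2} = {k : ℕ | c ≤ |(k : ℝ) - r|} := by
    ext k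
    rw [Set.mem_ofPred_eq, Set.mem_ofPred_eq, sq_le_sq, abs_of_pos hc]
  have hmarkov := mul_meas_ge_le_integral_of_nonneg
    (ae_of_all _ fun k : ℕ => sq_nonneg ((k : ℝ) - r)) hint (c ^ 2)
  rw [hset, hval] at hmarkov
  rwa [le_div_iff₀' (by positivity)]

theorem poissonMeasure_prod_real_deviation_le (a b : ℝ≥0) {c : ℝ} (hc : 0 < c) :
    ((poissonMeasure a).prod (poissonMeasure b)).real
      {m | c ≤ |(m.1 : ℝ) - a| ∨ c ≤ |(m.2 : ℝ) - b|} ≤ (a + b) / c ^ 2 := by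
  have hset : {m : ℕ × ℕ | c ≤ |(m.1 : ℝ) - a| ∨ c ≤ |(m.2 : ℝ) - b|} =
      {k : ℕ | c ≤ |(k : ℝ) - a|} ×ˢ Set.univ ∪ Set.univ ×ˢ {k : ℕ | c ≤ |(k : ℝ) - b|} := by
    ext m
    simp
  rw [hset, add_div]
  refine (measureReal_union_le _ _).trans ?_
  rw [measureReal_prod_prod, measureReal_prod_prod, probReal_univ, probReal_univ, one_mul, mul_one]
  exact add_le_add (poissonMeasure_real_le_abs_sub_le a hc) (poissonMeasure_real_le_abs_sub_le b hc)

theorem isLittleO_poissonMeasure_real_singleton_succ (r : ℕ) :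
    (fun a : ℝ≥0 => (poissonMeasure a).real {r}) =o[atTop]
      fun a : ℝ≥0 => (poissonMeasure a).real {r + 1} := by
  have hratio : Tendsto (fun a : ℝ≥0 => ((r + 1 : ℕ) : ℝ) / a) atTop (𝓝 0) :=
    (NNReal.tendsto_coe_atTop.2 tendsto_id).const_div_atTop _
  refine Asymptotics.isLittleO_of_tendsto' ?_ (hratio.congr' ?_)
  · filter_upwards [eventually_gt_atTop 0] with a ha h0
    exact absurd h0 (poissonMeasure_real_singleton_pos _ ha).ne'
  · filter_upwards [eventually_gt_atTop 0] with a ha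
    rw [poissonMeasure_real_singleton, poissonMeasure_real_singleton, Nat.factorial_succ]
    have : (a : ℝ) ≠ 0 := by positivity
    push_cast
    field_simp
    ring

theorem isEquivalent_poissonMeasure_real_Iic (r : ℕ) :
    Asymptotics.IsEquivalent atTop (fun a : ℝ≥0 => (poissonMeasure a).real (Set.Iic r))
      fun a : ℝ≥0 => (poissonMeasure a).real {r} := by
  induction r with
  | zero =>
    have hzero : Set.Iic (0 : ℕ) = {0} := Set.Iic_bot
    rw [hzero]
  | succ r ih =>
    have hsplit : ∀ a : ℝ≥0, (poissonMeasure a).real (Set.Iic (r + 1)) =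
        (poissonMeasure a).real (Set.Iic r) + (poissonMeasure a).real {r + 1} := fun a => by
      rw [← measureReal_union (by simp) (measurableSet_singleton _)]
      congr 1
      ext k
      simp only [Set.mem_Iic, Set.mem_union, Set.mem_singleton_iff]
      omega
    simp only [hsplit]
    exact (ih.isBigO.trans_isLittleO
      (isLittleO_poissonMeasure_real_singleton_succ r)).add_isEquivalent .refl

theorem tendsto_poissonMeasure_real_Iic_atTop (r : ℕ) :
    Tendsto (fun a : ℝ≥0 => (poissonMeasure a).real (Set.Iic r)) atTop (𝓝 0) := by
  refine (isEquivalent_poissonMeasure_real_Iic r).symm.tendsto_nhds ?_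
  simp only [poissonMeasure_real_singleton]
  simpa [mul_comm] using ((Real.tendsto_pow_mul_exp_neg_atTop_nhds_zero r).comp
    (NNReal.tendsto_coe_atTop.2 tendsto_id)).div_const (r ! : ℝ)

/-- The probability that a Poisson process counts more than `r₁` points by time `a` and more than
`r₂` points by time `a + b`. -/
noncomputable def poissonExceed (r₁ r₂ : ℕ) (a b : ℝ≥0) : ℝ :=
  ((poissonMeasure a).prod (poissonMeasure b)).real {m | r₁ < m.1 ∧ r₂ < m.1 + m.2}

theorem abs_one_sub_poissonExceed_sub_le (r₁ r₂ : ℕ) (a b : ℝ≥0) :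
    |1 - poissonExceed r₁ r₂ a b -
        ((poissonMeasure a).real (Set.Iic r₁) + (poissonMeasure (a + b)).real (Set.Iic r₂))| ≤
      (poissonMeasure a).real (Set.Iic r₁) * (poissonMeasure b).real (Set.Iic r₂) := by
  set μ := (poissonMeasure a).prod (poissonMeasure b) with hμ
  set A : Set (ℕ × ℕ) := Set.Iic r₁ ×ˢ Set.univ with hA
  set B : Set (ℕ × ℕ) := {m | m.1 + m.2 ≤ r₂} with hB
  have hμA : μ.real A = (poissonMeasure a).real (Set.Iic r₁) := by
    rw [hμ, measureReal_prod_prod, probReal_univ, mul_one]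
  have hμB : μ.real B = (poissonMeasure (a + b)).real (Set.Iic r₂) := by
    rw [← poissonMeasure_conv_poissonMeasure, Measure.conv,
      map_measureReal_apply (by fun_prop) measurableSet_Iic]
    rfl
  have hinter : μ.real (A ∩ B) ≤
      (poissonMeasure a).real (Set.Iic r₁) * (poissonMeasure b).real (Set.Iic r₂) := by
    rw [← measureReal_prod_prod]
    exact measureReal_mono fun m ⟨hmA, hmB⟩ => ⟨hmA.1, (Nat.le_add_left m.2 m.1).trans hmB⟩
  have hcompl : 1 - poissonExceed r₁ r₂ a b = μ.real (A ∪ B) := by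
    rw [poissonExceed, ← probReal_compl_eq_one_sub MeasurableSet.of_discrete]
    congr 1
    ext m
    simp only [hA, hB, Set.mem_compl_iff, Set.mem_ofPred_eq, Set.mem_union, Set.mem_prod,
      Set.mem_Iic, Set.mem_univ, and_true]
    grind
  have hunion := measureReal_union_add_inter (μ := μ) (s := A) (t := B) MeasurableSet.of_discrete
  rw [hμA, hμB] at hunion
  rw [hcompl, ← hunion, sub_add_cancel_left, abs_neg, abs_of_nonneg measureReal_nonneg]
  exact hinter

theorem tendsto_poissonExceed_pow (r₁ r₂ : ℕ) {a b : ℕ → ℝ≥0} {x y : ℝ}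
    (ha : Tendsto a atTop atTop) (hb : Tendsto b atTop atTop)
    (hx : Tendsto (fun n : ℕ => n * (poissonMeasure (a n)).real {r₁}) atTop (𝓝 x))
    (hy : Tendsto (fun n : ℕ => n * (poissonMeasure (a n + b n)).real {r₂}) atTop (𝓝 y)) :
    Tendsto (fun n => poissonExceed r₁ r₂ (a n) (b n) ^ n) atTop (𝓝 (Real.exp (-(x + y)))) := by
  have hIic : ∀ {r : ℕ} {c : ℕ → ℝ≥0} {z : ℝ}, Tendsto c atTop atTop →
      Tendsto (fun n : ℕ => n * (poissonMeasure (c n)).real {r}) atTop (𝓝 z) →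
      Tendsto (fun n : ℕ => n * (poissonMeasure (c n)).real (Set.Iic r)) atTop (𝓝 z) :=
    fun hc hz => (Asymptotics.IsEquivalent.refl.mul
      ((isEquivalent_poissonMeasure_real_Iic _).symm.comp_tendsto hc)).tendsto_nhds hz
  have hmain := (hIic ha hx).add (hIic (ha.atTop_add_atTop hb) hy)
  have herror : Tendsto (fun n : ℕ => n * (1 - poissonExceed r₁ r₂ (a n) (b n) -
      ((poissonMeasure (a n)).real (Set.Iic r₁) +
        (poissonMeasure (a n + b n)).real (Set.Iic r₂)))) atTop (𝓝 0) := by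
    have hbound := (hIic ha hx).mul ((tendsto_poissonMeasure_real_Iic_atTop r₂).comp hb)
    rw [mul_zero] at hbound
    refine squeeze_zero_norm (fun n => ?_) hbound
    rw [norm_mul, Real.norm_natCast, mul_assoc]
    exact mul_le_mul_of_nonneg_left (abs_one_sub_poissonExceed_sub_le _ _ _ _) n.cast_nonneg
  have hexceed : Tendsto (fun n : ℕ => n * (poissonExceed r₁ r₂ (a n) (b n) - 1)) atTop
      (𝓝 (-(x + y))) := by
    rw [← add_zero (x + y)]
    exact (hmain.add herror).neg.congr fun n => by ring
  exact (Real.tendsto_one_add_pow_exp_of_tendsto hexceed).congr fun n => by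
    rw [add_sub_cancel]

end Poisson

section CompletionTime

theorem measurable_sInf_nat {Ω : Type*} [MeasurableSpace Ω] {s : Ω → Set ℕ}
    (hs : ∀ t, MeasurableSet {ω | t ∈ s ω}) : Measurable fun ω => sInf (s ω) := by
  refine measurable_of_Iic fun m => ?_
  have hset : (fun ω => sInf (s ω)) ⁻¹' Set.Iic m =
      (⋃ t ∈ Set.Iic m, {ω | t ∈ s ω}) ∪ ⋂ t, {ω | t ∈ s ω}ᶜ := by
    ext ω
    simp only [Set.mem_preimage, Set.mem_Iic, Set.mem_union, Set.mem_iUnion, Set.mem_iInter,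
      Set.mem_compl_iff, Set.mem_ofPred_eq, exists_prop]
    rcases (s ω).eq_empty_or_nonempty with h | h
    · simp [h]
    · exact ⟨fun hm => Or.inl ⟨_, hm, Nat.sInf_mem h⟩, fun hm => hm.elim
        (fun ⟨_, htm, ht⟩ => (Nat.sInf_le ht).trans htm) fun hnot => (hnot _ h.some_mem).elim⟩
  rw [hset]
  exact (MeasurableSet.biUnion (Set.to_countable _) fun t _ => hs t).union
    (MeasurableSet.iInter fun t => (hs t).compl)

variable {Ω α : Type*} [MeasurableSpace Ω] [MeasurableSpace α] [MeasurableSingletonClass α]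
  {P : Measure Ω} {C : ℕ → Ω → α} {p : α → ℝ≥0}

theorem IsCouponSequence.ae_frequently_eq (h : IsCouponSequence C p P) {i : α} (hi : p i ≠ 0) :
    ∀ᵐ ω ∂P, ∃ᶠ k in atTop, C k ω = i := by
  have := h.iIndepFun.isProbabilityMeasure
  have hmeas : ∀ k, MeasurableSet {ω | C k ω = i} :=
    fun k => h.measurable k (measurableSet_singleton i)
  have hindep : iIndepSet (fun k => {ω | C k ω = i}) P := by
    rw [iIndepSet_iff_meas_biInter hmeas]
    exact fun s => h.iIndepFun.meas_biInter fun k _ => ⟨{i}, measurableSet_singleton i, rfl⟩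
  have hsum : ∑' k, P {ω | C k ω = i} = ∞ := by
    have hP : ∀ k, P {ω | C k ω = i} = p i := fun k => by
      rw [← ofReal_measureReal, h.measureReal_eq, ENNReal.ofReal_coe_nnreal]
    simp only [hP]
    exact ENNReal.tsum_const_eq_top_of_ne_zero (ENNReal.coe_ne_zero.2 hi)
  filter_upwards [(mem_ae_iff_prob_eq_one (MeasurableSet.measurableSet_limsup hmeas)).2
    (measure_limsup_eq_one hmeas hindep hsum)] with ω hω
  exact (mem_limsup_iff_frequently_mem (s := fun k => {ω | C k ω = i})).1 hω

theorem measurable_completionTime [Countable α] (hC : ∀ k, Measurable (C k)) (r : ℕ) :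
    Measurable fun ω => completionTime (fun k => C k ω) r := by
  classical
  refine measurable_sInf_nat fun t => ?_
  change MeasurableSet {ω | album (fun k => C k ω) t r = Set.univ}
  simp only [album_eq_univ_iff, Set.ofPred_forall]
  exact MeasurableSet.iInter fun i =>
    measurableSet_lt measurable_const ((measurable_pi_apply i).comp (measurable_couponCount hC t))

theorem IsCouponSequence.ae_completionTime_le_iff [Finite α] [DecidableEq α]
    (h : IsCouponSequence C p P) (hp : ∀ i, p i ≠ 0) :
    ∀ᵐ ω ∂P, ∀ r m, completionTime (fun k => C k ω) r ≤ m ↔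
      ∀ i, r < couponCount (fun k => C k ω) m i := by
  filter_upwards [ae_all_iff.2 fun i => h.ae_frequently_eq (hp i)] with ω hω r m
  exact completionTime_le_iff (exists_album_eq_univ hω r) m

end CompletionTime

section Poissonization

section ProdComparison

variable {Ω β : Type*} [MeasurableSpace Ω] [MeasurableSpace β] {P : Measure Ω} {μ : Measure β}
  [IsProbabilityMeasure P] [IsProbabilityMeasure μ] {E : Set Ω} {D : Set β} {F : Set (Ω × β)}

theorem measureReal_le_prod_measureReal_add (h : ∀ ω ∈ E, ∀ m ∉ D, (ω, m) ∈ F) :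
    P.real E ≤ (P.prod μ).real F + μ.real D := by
  calc P.real E = (P.prod μ).real (E ×ˢ Set.univ) := by
        rw [measureReal_prod_prod, probReal_univ, mul_one]
    _ ≤ (P.prod μ).real (F ∪ Set.univ ×ˢ D) :=
        measureReal_mono fun q hq => or_iff_not_imp_right.2 fun hD =>
          h q.1 hq.1 q.2 fun hq2 => hD ⟨trivial, hq2⟩
    _ ≤ (P.prod μ).real F + (P.prod μ).real (Set.univ ×ˢ D) := measureReal_union_le _ _
    _ = (P.prod μ).real F + μ.real D := by rw [measureReal_prod_prod, probReal_univ, one_mul]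

theorem prod_measureReal_le_measureReal_add (h : ∀ q ∈ F, q.2 ∉ D → q.1 ∈ E) :
    (P.prod μ).real F ≤ P.real E + μ.real D := by
  calc (P.prod μ).real F ≤ (P.prod μ).real (E ×ˢ Set.univ ∪ Set.univ ×ˢ D) :=
        measureReal_mono fun q hq => or_iff_not_imp_right.2 fun hD =>
          ⟨h q hq fun hq2 => hD ⟨trivial, hq2⟩, trivial⟩
    _ ≤ (P.prod μ).real (E ×ˢ Set.univ) + (P.prod μ).real (Set.univ ×ˢ D) :=
        measureReal_union_le _ _
    _ = P.real E + μ.real D := by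
        rw [measureReal_prod_prod, measureReal_prod_prod, probReal_univ, probReal_univ, mul_one,
          one_mul]

end ProdComparison

variable {Ω α : Type*} [MeasurableSpace Ω] [MeasurableSpace α] [MeasurableSingletonClass α]
  [Fintype α] {P : Measure Ω} {C : ℕ → Ω → α} {p : α → ℝ≥0}

theorem IsCouponSequence.measureReal_prod_completionTime_le (h : IsCouponSequence C p P)
    (hp : ∀ i, p i ≠ 0) (r₁ r₂ : ℕ) (a b : ℝ≥0) :
    (P.prod ((poissonMeasure a).prod (poissonMeasure b))).real
        {q | completionTime (fun k => C k q.1) r₁ ≤ q.2.1 ∧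
          completionTime (fun k => C k q.1) r₂ ≤ q.2.1 + q.2.2} =
      ∏ i, poissonExceed r₁ r₂ (a * p i) (b * p i) := by
  classical
  have := h.iIndepFun.isProbabilityMeasure
  let V : Set (α → ℕ × ℕ) := Set.univ.pi fun _ => {m | r₁ < m.1 ∧ r₂ < m.1 + m.2}
  calc (P.prod ((poissonMeasure a).prod (poissonMeasure b))).real
        {q | completionTime (fun k => C k q.1) r₁ ≤ q.2.1 ∧
          completionTime (fun k => C k q.1) r₂ ≤ q.2.1 + q.2.2}
      = (P.prod ((poissonMeasure a).prod (poissonMeasure b))).real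
          ((fun q => blockCounts (fun k => C k q.1) q.2) ⁻¹' V) := by
        refine measureReal_congr (eventuallyEq_set.2 ?_)
        filter_upwards [Measure.quasiMeasurePreserving_fst.ae (h.ae_completionTime_le_iff hp)]
          with q hq
        simp only [Set.mem_ofPred_eq, hq, ← forall_and, couponCount_add, Set.mem_preimage, V,
          Set.mem_univ_pi, Pi.add_apply, blockCounts]
    _ = (Measure.pi fun i =>
          (poissonMeasure (a * p i)).prod (poissonMeasure (b * p i))).real V := by
        rw [← h.map_blockCounts, map_measureReal_apply (measurable_blockCounts h.measurable)
          (MeasurableSet.univ_pi fun _ => .of_discrete)]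
    _ = ∏ i, poissonExceed r₁ r₂ (a * p i) (b * p i) := by
        simp only [measureReal_def, V, Measure.pi_pi, ENNReal.toReal_prod, poissonExceed]

theorem IsCouponSequence.measureReal_completionTime_le_le (h : IsCouponSequence C p P)
    (hp : ∀ i, p i ≠ 0) (r₁ r₂ : ℕ) {a b : ℝ≥0} {c s t : ℝ} (hc : 0 < c) (hs : s + c ≤ a)
    (ht : t - s + c ≤ b) :
    P.real {ω | completionTime (fun k => C k ω) r₁ ≤ s ∧
        completionTime (fun k => C k ω) r₂ ≤ t} ≤
      ∏ i, poissonExceed r₁ r₂ (a * p i) (b * p i) + (a + b) / c ^ 2 := by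
  have := h.iIndepFun.isProbabilityMeasure
  rw [← h.measureReal_prod_completionTime_le hp]
  refine (measureReal_le_prod_measureReal_add ?_).trans
    (add_le_add_right (poissonMeasure_prod_real_deviation_le a b hc) _)
  rintro ω ⟨h₁, h₂⟩ ⟨m, k⟩ hdev
  simp only [Set.mem_ofPred_eq, not_or, not_le, abs_sub_lt_iff] at hdev
  exact ⟨by exact_mod_cast (by linarith : (completionTime (fun k => C k ω) r₁ : ℝ) ≤ m),
    by exact_mod_cast (by linarith : (completionTime (fun k => C k ω) r₂ : ℝ) ≤ m + k)⟩

theorem IsCouponSequence.le_measureReal_completionTime_le (h : IsCouponSequence C p P)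
    (hp : ∀ i, p i ≠ 0) (r₁ r₂ : ℕ) {a b : ℝ≥0} {c s t : ℝ} (hc : 0 < c) (hs : a + c ≤ s)
    (ht : b + c ≤ t - s) :
    ∏ i, poissonExceed r₁ r₂ (a * p i) (b * p i) ≤
      P.real {ω | completionTime (fun k => C k ω) r₁ ≤ s ∧
        completionTime (fun k => C k ω) r₂ ≤ t} + (a + b) / c ^ 2 := by
  have := h.iIndepFun.isProbabilityMeasure
  rw [← h.measureReal_prod_completionTime_le hp]
  refine (prod_measureReal_le_measureReal_add ?_).trans
    (add_le_add_right (poissonMeasure_prod_real_deviation_le a b hc) _)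
  rintro ⟨ω, m, k⟩ ⟨h₁, h₂⟩ hdev
  simp only [Set.mem_ofPred_eq, not_or, not_le, abs_sub_lt_iff] at hdev
  have h₁' : (completionTime (fun k => C k ω) r₁ : ℝ) ≤ m := by exact_mod_cast h₁
  have h₂' : (completionTime (fun k => C k ω) r₂ : ℝ) ≤ m + k := by exact_mod_cast h₂
  exact ⟨by linarith, by linarith⟩

end Poissonization

section Normalization

/-- The time scale `log n + r log log n + x`: the completion time of collector `r` divided by the
number `n` of types is of this order, with `x` the value of the fluctuation. -/
noncomputable def completionScale (r : ℕ) (x : ℝ) (n : ℕ) : ℝ :=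
  Real.log n + r * Real.log (Real.log n) + x

theorem completionScale_add (r : ℕ) (x y : ℝ) (n : ℕ) :
    completionScale r (x + y) n = completionScale r x n + y :=
  (add_assoc _ _ _).symm

theorem tendsto_log_natCast_atTop : Tendsto (fun n : ℕ => Real.log n) atTop atTop :=
  Real.tendsto_log_atTop.comp tendsto_natCast_atTop_atTop

theorem tendsto_completionScale_div_log (r : ℕ) (x : ℝ) :
    Tendsto (fun n : ℕ => completionScale r x n / Real.log n) atTop (𝓝 1) := by
  have hloglog : Tendsto (fun n : ℕ => Real.log (Real.log n) / Real.log n) atTop (𝓝 0) :=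
    Real.isLittleO_log_id_atTop.tendsto_div_nhds_zero.comp tendsto_log_natCast_atTop
  have hsum := ((hloglog.const_mul (r : ℝ)).const_add 1).add
    (tendsto_log_natCast_atTop.const_div_atTop x)
  rw [mul_zero, add_zero, add_zero] at hsum
  refine hsum.congr' ?_
  filter_upwards [tendsto_log_natCast_atTop.eventually_gt_atTop 0] with n hn
  rw [completionScale]
  field_simp

theorem tendsto_completionScale_atTop (r : ℕ) (x : ℝ) :
    Tendsto (completionScale r x) atTop atTop := by
  refine (tendsto_log_natCast_atTop.atTop_mul_pos one_pos
    (tendsto_completionScale_div_log r x)).congr' ?_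
  filter_upwards [tendsto_log_natCast_atTop.eventually_gt_atTop 0] with n hn
  exact mul_div_cancel₀ _ hn.ne'

theorem tendsto_completionScale_div (r : ℕ) (x : ℝ) :
    Tendsto (fun n : ℕ => completionScale r x n / n) atTop (𝓝 0) := by
  have hlog : Tendsto (fun n : ℕ => Real.log n / n) atTop (𝓝 0) :=
    Real.isLittleO_log_id_atTop.tendsto_div_nhds_zero.comp tendsto_natCast_atTop_atTop
  have hmul := (tendsto_completionScale_div_log r x).mul hlog
  rw [mul_zero] at hmul
  refine hmul.congr' ?_
  filter_upwards [tendsto_log_natCast_atTop.eventually_gt_atTop 0] with n hn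
  exact div_mul_div_cancel₀ hn.ne'

theorem tendsto_completionScale_sub_atTop {r₁ r₂ : ℕ} (hr : r₁ < r₂) (x y : ℝ) :
    Tendsto (fun n => completionScale r₂ y n - completionScale r₁ x n) atTop atTop := by
  have hr' : (0 : ℝ) < r₂ - r₁ := sub_pos.2 (by exact_mod_cast hr)
  refine (tendsto_atTop_add_const_right _ (y - x) ((Real.tendsto_log_atTop.comp
    tendsto_log_natCast_atTop).const_mul_atTop hr')).congr fun n => ?_
  simp only [completionScale, Function.comp_apply]
  ring

theorem tendsto_mul_poissonMeasure_completionScale (r : ℕ) (x : ℝ) :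
    Tendsto (fun n : ℕ => n * (poissonMeasure (completionScale r x n).toNNReal).real {r}) atTop
      (𝓝 (Real.exp (-x) / r !)) := by
  have hpow := ((tendsto_completionScale_div_log r x).pow r).mul_const (Real.exp (-x) / r !)
  rw [one_pow, one_mul] at hpow
  refine hpow.congr' ?_
  filter_upwards [tendsto_log_natCast_atTop.eventually_gt_atTop 0, eventually_gt_atTop 0,
    (tendsto_completionScale_atTop r x).eventually_ge_atTop 0] with n hlog hn hscale
  have hexp : Real.exp (-completionScale r x n) =
      (n : ℝ)⁻¹ * (Real.log n ^ r)⁻¹ * Real.exp (-x) := by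
    rw [completionScale, neg_add, neg_add, Real.exp_add, Real.exp_add, Real.exp_neg,
      Real.exp_log (by exact_mod_cast hn), Real.exp_neg, Real.exp_nat_mul, Real.exp_log hlog]
  have hn' : (n : ℝ) ≠ 0 := by exact_mod_cast hn.ne'
  rw [poissonMeasure_real_singleton, Real.coe_toNNReal _ hscale, hexp, div_pow]
  field_simp

theorem tendsto_poissonExceed_completionScale_pow {r₁ r₂ : ℕ} (hr : r₁ < r₂) (x y : ℝ) :
    Tendsto (fun n => poissonExceed r₁ r₂ (completionScale r₁ x n).toNNReal
      (completionScale r₂ y n - completionScale r₁ x n).toNNReal ^ n) atTop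
      (𝓝 (Real.exp (-(Real.exp (-x) / r₁ ! + Real.exp (-y) / r₂ !)))) := by
  refine tendsto_poissonExceed_pow r₁ r₂
    (tendsto_real_toNNReal_atTop.comp (tendsto_completionScale_atTop r₁ x))
    (tendsto_real_toNNReal_atTop.comp (tendsto_completionScale_sub_atTop hr x y))
    (tendsto_mul_poissonMeasure_completionScale r₁ x)
    ((tendsto_mul_poissonMeasure_completionScale r₂ y).congr' ?_)
  filter_upwards [(tendsto_completionScale_atTop r₁ x).eventually_ge_atTop 0,
    (tendsto_completionScale_sub_atTop hr x y).eventually_ge_atTop 0] with n h₁ h₂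
  rw [← Real.toNNReal_add h₁ h₂, add_sub_cancel]

/-- The joint distribution function at `(x + ε, y + 2 * ε)` of two normalized completion times in
the Poissonized model with `n` types, with a correction for the fluctuations of the Poisson clock
which has the sign of `ε`. It bounds the distribution function at `(x, y)` in the original model
from above if `0 < ε` and from below if `ε < 0`. -/
noncomputable def poissonizedCdf (r₁ r₂ : ℕ) (x y ε : ℝ) (n : ℕ) : ℝ :=
  poissonExceed r₁ r₂ (completionScale r₁ (x + ε) n).toNNReal
      (completionScale r₂ (y + 2 * ε) n - completionScale r₁ (x + ε) n).toNNReal ^ n +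
    completionScale r₂ (y + 2 * ε) n / n / (ε * |ε|)

theorem tendsto_poissonizedCdf {r₁ r₂ : ℕ} (hr : r₁ < r₂) (x y ε : ℝ) :
    Tendsto (poissonizedCdf r₁ r₂ x y ε) atTop
      (𝓝 (Real.exp (-(Real.exp (-(x + ε)) / r₁ ! + Real.exp (-(y + 2 * ε)) / r₂ !)))) := by
  have hsum := (tendsto_poissonExceed_completionScale_pow hr (x + ε) (y + 2 * ε)).add
    ((tendsto_completionScale_div r₂ (y + 2 * ε)).div_const (ε * |ε|))
  rwa [zero_div, add_zero] at hsum

end Normalization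

section UniformCoupons

/-- The completion time of collector `r`, centred and scaled so as to have a nondegenerate limit
law when the number of coupon types tends to infinity. -/
noncomputable def normalizedTime {α : Type*} [Fintype α] (c : ℕ → α) (r : ℕ) : ℝ :=
  completionTime c r / Fintype.card α - Real.log (Fintype.card α) -
    r * Real.log (Real.log (Fintype.card α))

theorem normalizedTime_le_iff {α : Type*} [Fintype α] [Nonempty α] (c : ℕ → α) (r : ℕ) (x : ℝ) :
    normalizedTime c r ≤ x ↔
      completionTime c r ≤ Fintype.card α * completionScale r x (Fintype.card α) := by
  have hcard : (0 : ℝ) < Fintype.card α := by exact_mod_cast Fintype.card_pos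
  rw [← div_le_iff₀' hcard, normalizedTime, completionScale]
  constructor <;> intro h <;> linarith

theorem prod_poissonExceed_card_mul_inv (α : Type*) [Fintype α] [Nonempty α] (r₁ r₂ : ℕ)
    (a b : ℝ≥0) :
    ∏ _i : α, poissonExceed r₁ r₂ (Fintype.card α * a * (Fintype.card α : ℝ≥0)⁻¹)
      (Fintype.card α * b * (Fintype.card α : ℝ≥0)⁻¹) =
      poissonExceed r₁ r₂ a b ^ Fintype.card α := by
  have hcard : (Fintype.card α : ℝ≥0) ≠ 0 := by exact_mod_cast Fintype.card_ne_zero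
  rw [mul_right_comm, mul_right_comm _ b, mul_inv_cancel₀ hcard, one_mul, one_mul,
    Finset.prod_const, Finset.card_univ]

variable {Ω α : Type*} [MeasurableSpace Ω] [MeasurableSpace α] [MeasurableSingletonClass α]
  [Fintype α] {P : Measure Ω} {C : ℕ → Ω → α}

theorem measurable_normalizedTime (hC : ∀ k, Measurable (C k)) (r : ℕ) :
    Measurable fun ω => normalizedTime (fun k => C k ω) r :=
  (((Measurable.of_discrete.comp (measurable_completionTime hC r)).div_const _).sub_const _
    ).sub_const _

theorem IsCouponSequence.measureReal_completionTime_le_card_mul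
    (h : IsCouponSequence C (fun _ => (Fintype.card α : ℝ≥0)⁻¹) P) (r₁ r₂ : ℕ) {a b : ℝ≥0}
    {ε s t : ℝ} (hε : 0 < ε) (hs : s + ε ≤ a) (ht : t - s + ε ≤ b) :
    P.real {ω | completionTime (fun k => C k ω) r₁ ≤ Fintype.card α * s ∧
        completionTime (fun k => C k ω) r₂ ≤ Fintype.card α * t} ≤
      poissonExceed r₁ r₂ a b ^ Fintype.card α + (a + b) / Fintype.card α / ε ^ 2 := by
  have := h.nonempty
  have hcard : (0 : ℝ) < Fintype.card α := by exact_mod_cast Fintype.card_pos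
  have hs' := mul_le_mul_of_nonneg_left hs hcard.le
  have ht' := mul_le_mul_of_nonneg_left ht hcard.le
  refine (h.measureReal_completionTime_le_le (a := Fintype.card α * a) (b := Fintype.card α * b)
    (by simp) r₁ r₂ (mul_pos hcard hε) ?_ ?_).trans_eq ?_
  · push_cast
    linarith
  · push_cast
    linarith
  · rw [prod_poissonExceed_card_mul_inv]
    push_cast
    field_simp

theorem IsCouponSequence.le_measureReal_completionTime_le_card_mul
    (h : IsCouponSequence C (fun _ => (Fintype.card α : ℝ≥0)⁻¹) P) (r₁ r₂ : ℕ) {a b : ℝ≥0}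
    {ε s t : ℝ} (hε : 0 < ε) (hs : a + ε ≤ s) (ht : b + ε ≤ t - s) :
    poissonExceed r₁ r₂ a b ^ Fintype.card α ≤
      P.real {ω | completionTime (fun k => C k ω) r₁ ≤ Fintype.card α * s ∧
        completionTime (fun k => C k ω) r₂ ≤ Fintype.card α * t} +
      (a + b) / Fintype.card α / ε ^ 2 := by
  have := h.nonempty
  have hcard : (0 : ℝ) < Fintype.card α := by exact_mod_cast Fintype.card_pos
  have hs' := mul_le_mul_of_nonneg_left hs hcard.le
  have ht' := mul_le_mul_of_nonneg_left ht hcard.le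
  rw [← prod_poissonExceed_card_mul_inv]
  refine (h.le_measureReal_completionTime_le (by simp) r₁ r₂ (mul_pos hcard hε)
    (s := Fintype.card α * s) (t := Fintype.card α * t) ?_ ?_).trans_eq ?_
  · push_cast
    linarith
  · push_cast
    linarith
  · push_cast
    field_simp

theorem IsCouponSequence.measureReal_normalizedTime_le_poissonizedCdf
    (h : IsCouponSequence C (fun _ => (Fintype.card α : ℝ≥0)⁻¹) P) {r₁ r₂ : ℕ} {x y ε : ℝ}
    (hε : 0 < ε) (h₁ : 0 ≤ completionScale r₁ (x + ε) (Fintype.card α))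
    (h₂ : 0 ≤ completionScale r₂ (y + 2 * ε) (Fintype.card α) -
      completionScale r₁ (x + ε) (Fintype.card α)) :
    P.real {ω | normalizedTime (fun k => C k ω) r₁ ≤ x ∧ normalizedTime (fun k => C k ω) r₂ ≤ y} ≤
      poissonizedCdf r₁ r₂ x y ε (Fintype.card α) := by
  have := h.nonempty
  have hbound := h.measureReal_completionTime_le_card_mul r₁ r₂
    (a := (completionScale r₁ (x + ε) (Fintype.card α)).toNNReal)
    (b := (completionScale r₂ (y + 2 * ε) (Fintype.card α) -
      completionScale r₁ (x + ε) (Fintype.card α)).toNNReal)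
    (s := completionScale r₁ x (Fintype.card α)) (t := completionScale r₂ y (Fintype.card α)) hε
    (by rw [Real.coe_toNNReal _ h₁, completionScale_add])
    (by rw [Real.coe_toNNReal _ h₂, completionScale_add, completionScale_add]; linarith)
  rw [Real.coe_toNNReal _ h₁, Real.coe_toNNReal _ h₂, add_sub_cancel] at hbound
  simp only [normalizedTime_le_iff]
  rwa [poissonizedCdf, abs_of_pos hε, ← sq]

theorem IsCouponSequence.poissonizedCdf_le_measureReal_normalizedTime
    (h : IsCouponSequence C (fun _ => (Fintype.card α : ℝ≥0)⁻¹) P) {r₁ r₂ : ℕ} {x y ε : ℝ}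
    (hε : ε < 0) (h₁ : 0 ≤ completionScale r₁ (x + ε) (Fintype.card α))
    (h₂ : 0 ≤ completionScale r₂ (y + 2 * ε) (Fintype.card α) -
      completionScale r₁ (x + ε) (Fintype.card α)) :
    poissonizedCdf r₁ r₂ x y ε (Fintype.card α) ≤ P.real {ω |
      normalizedTime (fun k => C k ω) r₁ ≤ x ∧ normalizedTime (fun k => C k ω) r₂ ≤ y} := by
  have := h.nonempty
  have hbound := h.le_measureReal_completionTime_le_card_mul r₁ r₂
    (a := (completionScale r₁ (x + ε) (Fintype.card α)).toNNReal)
    (b := (completionScale r₂ (y + 2 * ε) (Fintype.card α) -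
      completionScale r₁ (x + ε) (Fintype.card α)).toNNReal)
    (s := completionScale r₁ x (Fintype.card α)) (t := completionScale r₂ y (Fintype.card α))
    (neg_pos.2 hε)
    (by rw [Real.coe_toNNReal _ h₁, completionScale_add, add_neg_cancel_right])
    (by rw [Real.coe_toNNReal _ h₂, completionScale_add, completionScale_add]; linarith)
  rw [Real.coe_toNNReal _ h₁, Real.coe_toNNReal _ h₂, add_sub_cancel, neg_sq] at hbound
  simp only [normalizedTime_le_iff]
  rw [poissonizedCdf, abs_of_neg hε, mul_neg, div_neg, ← sub_eq_add_neg, ← sq]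
  exact sub_le_iff_le_add.2 hbound

end UniformCoupons

section JointLimit

theorem tendsto_of_forall_eventually_le_of_forall_eventually_ge {ι : Type*} {l : Filter ι}
    {f : ι → ℝ} {u : ℝ → ι → ℝ} {G : ℝ → ℝ} (hG : ContinuousAt G 0)
    (hu : ∀ ε, Tendsto (u ε) l (𝓝 (G ε))) (hle : ∀ ε > 0, ∀ᶠ i in l, f i ≤ u ε i)
    (hge : ∀ ε < 0, ∀ᶠ i in l, u ε i ≤ f i) : Tendsto f l (𝓝 (G 0)) := by
  refine tendsto_order.2 ⟨fun v hv => ?_, fun v hv => ?_⟩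
  · obtain ⟨ε, hvε, hε⟩ := (((hG.mono_left nhdsWithin_le_nhds).eventually_const_lt hv).and
      (self_mem_nhdsWithin (s := Set.Iio (0 : ℝ)))).exists
    filter_upwards [(hu ε).eventually_const_lt hvε, hge ε hε] with i hvi hi
    exact hvi.trans_le hi
  · obtain ⟨ε, hεv, hε⟩ := (((hG.mono_left nhdsWithin_le_nhds).eventually_lt_const hv).and
      (self_mem_nhdsWithin (s := Set.Ioi (0 : ℝ)))).exists
    filter_upwards [(hu ε).eventually_lt_const hεv, hle ε hε] with i hvi hi
    exact hi.trans_lt hvi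

variable {ι : Type*} {l : Filter ι} {Ω α : ι → Type*} [∀ i, MeasurableSpace (Ω i)]
  [∀ i, MeasurableSpace (α i)] [∀ i, MeasurableSingletonClass (α i)] [∀ i, Fintype (α i)]
  {P : ∀ i, Measure (Ω i)} {C : ∀ i, ℕ → Ω i → α i}

theorem tendsto_measureReal_normalizedTime_le_of_lt
    (hC : ∀ i, IsCouponSequence (C i) (fun _ => (Fintype.card (α i) : ℝ≥0)⁻¹) (P i))
    (hα : Tendsto (fun i => Fintype.card (α i)) l atTop) {r₁ r₂ : ℕ} (hr : r₁ < r₂) (x y : ℝ) :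
    Tendsto (fun i => (P i).real {ω | normalizedTime (fun k => C i k ω) r₁ ≤ x ∧
        normalizedTime (fun k => C i k ω) r₂ ≤ y}) l
      (𝓝 (Real.exp (-(Real.exp (-x) / r₁ ! + Real.exp (-y) / r₂ !)))) := by
  have hpos : ∀ ε, ∀ᶠ i in l, 0 ≤ completionScale r₁ (x + ε) (Fintype.card (α i)) ∧
      0 ≤ completionScale r₂ (y + 2 * ε) (Fintype.card (α i)) -
        completionScale r₁ (x + ε) (Fintype.card (α i)) := fun ε =>
    hα.eventually (((tendsto_completionScale_atTop r₁ (x + ε)).eventually_ge_atTop 0).and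
      ((tendsto_completionScale_sub_atTop hr (x + ε) (y + 2 * ε)).eventually_ge_atTop 0))
  have hcont : Continuous fun ε : ℝ =>
    Real.exp (-(Real.exp (-(x + ε)) / r₁ ! + Real.exp (-(y + 2 * ε)) / r₂ !)) := by fun_prop
  simpa only [add_zero, mul_zero] using
    tendsto_of_forall_eventually_le_of_forall_eventually_ge hcont.continuousAt
      (fun ε => (tendsto_poissonizedCdf hr x y ε).comp hα)
      (fun ε hε => (hpos ε).mono fun i hi =>
        (hC i).measureReal_normalizedTime_le_poissonizedCdf hε hi.1 hi.2)
      (fun ε hε => (hpos ε).mono fun i hi =>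
        (hC i).poissonizedCdf_le_measureReal_normalizedTime hε hi.1 hi.2)

theorem tendsto_measureReal_normalizedTime_le
    (hC : ∀ i, IsCouponSequence (C i) (fun _ => (Fintype.card (α i) : ℝ≥0)⁻¹) (P i))
    (hα : Tendsto (fun i => Fintype.card (α i)) l atTop) {r₁ r₂ : ℕ} (hr : r₁ ≠ r₂) (x y : ℝ) :
    Tendsto (fun i => (P i).real {ω | normalizedTime (fun k => C i k ω) r₁ ≤ x ∧
        normalizedTime (fun k => C i k ω) r₂ ≤ y}) l
      (𝓝 (Real.exp (-(Real.exp (-x) / r₁ ! + Real.exp (-y) / r₂ !)))) := by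
  rcases hr.lt_or_gt with hr | hr
  · exact tendsto_measureReal_normalizedTime_le_of_lt hC hα hr x y
  · simp_rw [and_comm (b := _ ≤ y), add_comm (Real.exp (-x) / _)]
    exact tendsto_measureReal_normalizedTime_le_of_lt hC hα hr y x

end JointLimit

section WeakConvergence

theorem measureReal_Ioc_prod_Ioc {α β : Type*} [LinearOrder α] [TopologicalSpace α]
    [ClosedIicTopology α] [MeasurableSpace α] [OpensMeasurableSpace α] [LinearOrder β]
    [TopologicalSpace β] [ClosedIicTopology β] [MeasurableSpace β] [OpensMeasurableSpace β]
    (μ : Measure (α × β)) [IsFiniteMeasure μ] (a b : α) (c d : β) :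
    μ.real (Set.Ioc a b ×ˢ Set.Ioc c d) =
      μ.real (Set.Iic b ×ˢ Set.Iic d) - μ.real (Set.Iic (min a b) ×ˢ Set.Iic d) -
        (μ.real (Set.Iic b ×ˢ Set.Iic (min c d)) -
          μ.real (Set.Iic (min a b) ×ˢ Set.Iic (min c d))) := by
  have hstrip : ∀ e, μ.real (Set.Iic b ×ˢ Set.Iic e) - μ.real (Set.Iic (min a b) ×ˢ Set.Iic e) =
      μ.real (Set.Ioc a b ×ˢ Set.Iic e) := fun e => by
    rw [← measureReal_sdiff (Set.prod_mono (Set.Iic_subset_Iic.2 (min_le_right a b)) subset_rfl)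
      (measurableSet_Iic.prod measurableSet_Iic)]
    congr 1
    ext p
    simp only [Set.mem_prod, Set.mem_Ioc, Set.mem_Iic, Set.mem_sdiff]
    grind
  rw [hstrip, hstrip, ← measureReal_sdiff
    (Set.prod_mono subset_rfl (Set.Iic_subset_Iic.2 (min_le_right c d)))
    (measurableSet_Ioc.prod measurableSet_Iic)]
  congr 1
  ext p
  simp only [Set.mem_prod, Set.mem_Ioc, Set.mem_Iic, Set.mem_sdiff]
  grind

theorem tendsto_probabilityMeasure_of_tendsto_Iic_prod_Iic {ι : Type*} {l : Filter ι}
    [l.IsCountablyGenerated] {μ : ι → ProbabilityMeasure (ℝ × ℝ)} {ν : ProbabilityMeasure (ℝ × ℝ)}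
    (h : ∀ x y, Tendsto (fun i => (μ i : Measure (ℝ × ℝ)).real (Set.Iic x ×ˢ Set.Iic y)) l
      (𝓝 ((ν : Measure (ℝ × ℝ)).real (Set.Iic x ×ˢ Set.Iic y)))) : Tendsto μ l (𝓝 ν) := by
  let S : Set (Set (ℝ × ℝ)) := {s | ∃ a b c d : ℝ, s = Set.Ioc a b ×ˢ Set.Ioc c d}
  have hS : IsPiSystem S := by
    rintro _ ⟨a, b, c, d, rfl⟩ _ ⟨a', b', c', d', rfl⟩ -
    exact ⟨_, _, _, _, by rw [Set.prod_inter_prod, Set.Ioc_inter_Ioc, Set.Ioc_inter_Ioc]⟩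
  refine hS.tendsto_probabilityMeasure_of_tendsto_of_mem ?_ ?_ ?_
  · rintro _ ⟨a, b, c, d, rfl⟩
    exact measurableSet_Ioc.prod measurableSet_Ioc
  · intro u hu p hp
    obtain ⟨ε, hε, hball⟩ := Metric.nhds_basis_closedBall.mem_iff.1 (hu.mem_nhds hp)
    have hmem : ∀ x : ℝ, Set.Ioc (x - ε) (x + ε) ∈ 𝓝 x := fun x =>
      Ioc_mem_nhds (sub_lt_self x hε) (lt_add_of_pos_right x hε)
    refine ⟨_, ⟨p.1 - ε, p.1 + ε, p.2 - ε, p.2 + ε, rfl⟩,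
      prod_mem_nhds (hmem p.1) (hmem p.2), subset_trans ?_ hball⟩
    rw [← closedBall_prod_same, Real.closedBall_eq_Icc, Real.closedBall_eq_Icc]
    exact Set.prod_mono Set.Ioc_subset_Icc_self Set.Ioc_subset_Icc_self
  · rintro _ ⟨a, b, c, d, rfl⟩
    have hrect : Tendsto (fun i => (μ i : Measure (ℝ × ℝ)).real (Set.Ioc a b ×ˢ Set.Ioc c d)) l
        (𝓝 ((ν : Measure (ℝ × ℝ)).real (Set.Ioc a b ×ˢ Set.Ioc c d))) := by
      simp only [measureReal_Ioc_prod_Ioc]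
      exact ((h _ _).sub (h _ _)).sub ((h _ _).sub (h _ _))
    simpa using hrect

theorem ext_of_measureReal_Iio {μ ν : Measure ℝ} [IsProbabilityMeasure μ]
    [IsProbabilityMeasure ν] (h : ∀ x, μ.real (Set.Iio x) = ν.real (Set.Iio x)) : μ = ν := by
  refine Measure.ext_of_Ici μ ν fun x => ?_
  rw [← measureReal_eq_measureReal_iff, ← Set.compl_Iio,
    probReal_compl_eq_one_sub measurableSet_Iio, probReal_compl_eq_one_sub measurableSet_Iio, h]

theorem tendstoInDistribution_of_identDistrib_limit {ι E Ω₁ Ω₂ : Type*} {Ω : ι → Type*}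
    [∀ i, MeasurableSpace (Ω i)] [MeasurableSpace Ω₁] [MeasurableSpace Ω₂] [MeasurableSpace E]
    [TopologicalSpace E] [OpensMeasurableSpace E] {μ : ∀ i, Measure (Ω i)}
    [∀ i, IsProbabilityMeasure (μ i)] {μ₁ : Measure Ω₁} [IsProbabilityMeasure μ₁]
    {μ₂ : Measure Ω₂} [IsProbabilityMeasure μ₂] {l : Filter ι} {X : ∀ i, Ω i → E} {Y : Ω₁ → E}
    {Z : Ω₂ → E} (hX : TendstoInDistribution X l Y μ μ₁) (hYZ : IdentDistrib Y Z μ₁ μ₂) :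
    TendstoInDistribution X l Z μ μ₂ := by
  refine ⟨hX.forall_aemeasurable, hYZ.aemeasurable_snd, ?_⟩
  simpa only [hYZ.map_eq] using hX.tendsto

end WeakConvergence

section Exponential

variable {a b : ℝ}

theorem measureReal_expMeasure_Ioi (ha : 0 < a) {c : ℝ} (hc : 0 ≤ c) :
    (expMeasure a).real (Set.Ioi c) = Real.exp (-(a * c)) := by
  have := isProbabilityMeasure_expMeasure ha
  rw [← Set.compl_Iic, probReal_compl_eq_one_sub measurableSet_Iic, ← cdf_eq_real,
    cdf_expMeasure_eq ha, if_pos hc, sub_sub_cancel]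

instance (a : ℝ) : NullSingletonClass (expMeasure a) :=
  ⟨fun _ => withDensity_absolutelyContinuous volume _ (measure_singleton _)⟩

theorem ae_expMeasure_pos (ha : 0 < a) : ∀ᵐ u ∂expMeasure a, 0 < u := by
  have := isProbabilityMeasure_expMeasure ha
  refine (mem_ae_iff_prob_eq_one (measurableSet_Ioi (a := (0 : ℝ)))).2 ?_
  rw [← ofReal_measureReal, measureReal_expMeasure_Ioi ha le_rfl, mul_zero, neg_zero,
    Real.exp_zero, ENNReal.ofReal_one]

theorem lintegral_exp_neg_mul_expMeasure (ha : 0 < a) (hb : 0 ≤ b) :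
    ∫⁻ u, ENNReal.ofReal (Real.exp (-(b * u))) ∂expMeasure a = ENNReal.ofReal (a / (a + b)) := by
  have hmeas : ∀ c, Measurable (exponentialPDF c) := fun c =>
    (measurable_exponentialPDFReal c).ennreal_ofReal
  have htilt : ∀ u, (exponentialPDF a * fun u => ENNReal.ofReal (Real.exp (-(b * u)))) u =
      ENNReal.ofReal (a / (a + b)) * exponentialPDF (a + b) u := fun u => by
    rcases lt_or_ge u 0 with hu | hu
    · rw [Pi.mul_apply, exponentialPDF_of_neg hu, exponentialPDF_of_neg hu, zero_mul, mul_zero]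
    · rw [Pi.mul_apply, exponentialPDF_of_nonneg hu, exponentialPDF_of_nonneg hu,
        ← ENNReal.ofReal_mul (by positivity), ← ENNReal.ofReal_mul (by positivity), add_mul a b u,
        neg_add, Real.exp_add]
      congr 1
      field_simp
  calc ∫⁻ u, ENNReal.ofReal (Real.exp (-(b * u))) ∂expMeasure a
      = ∫⁻ u, (exponentialPDF a * fun u => ENNReal.ofReal (Real.exp (-(b * u)))) u :=
        lintegral_withDensity_eq_lintegral_mul _ (hmeas a) (by fun_prop)
    _ = ENNReal.ofReal (a / (a + b)) := by
        simp_rw [htilt]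
        rw [lintegral_const_mul _ (hmeas _), lintegral_exponentialPDF_eq_one (by positivity),
          mul_one]

theorem measureReal_expMeasure_prod_expMeasure_mul_lt (ha : 0 < a) (hb : 0 < b) {c : ℝ}
    (hc : 0 ≤ c) :
    ((expMeasure a).prod (expMeasure b)).real {p | c * p.1 < p.2} = a / (a + b * c) := by
  have := isProbabilityMeasure_expMeasure hb
  have hsection : ∀ᵐ u ∂expMeasure a, expMeasure b (Prod.mk u ⁻¹' {p : ℝ × ℝ | c * p.1 < p.2}) =
      ENNReal.ofReal (Real.exp (-(b * c * u))) := by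
    filter_upwards [ae_expMeasure_pos ha] with u hu
    rw [mul_assoc, ← measureReal_expMeasure_Ioi hb (by positivity), ofReal_measureReal]
    rfl
  rw [measureReal_def, Measure.prod_apply (measurableSet_lt (by fun_prop) (by fun_prop)),
    lintegral_congr_ae hsection, lintegral_exp_neg_mul_expMeasure ha (by positivity),
    ENNReal.toReal_ofReal (by positivity)]

end Exponential

section Gumbel

/-- The Gumbel law with distribution function `exp (-exp (-x) / r!)`, the limit law of the
normalized completion time of collector `r`, as the law of `-log u` for an exponential variable
`u` of rate `1 / r!`. -/
noncomputable def gumbelMeasure (r : ℕ) : Measure ℝ :=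
  (expMeasure (r ! : ℝ)⁻¹).map fun u => -Real.log u

instance (r : ℕ) : IsProbabilityMeasure (gumbelMeasure r) :=
  have := isProbabilityMeasure_expMeasure (r := (r ! : ℝ)⁻¹) (by positivity)
  Measure.isProbabilityMeasure_map (by fun_prop)

theorem measureReal_gumbelMeasure_Iic (r : ℕ) (x : ℝ) :
    (gumbelMeasure r).real (Set.Iic x) = Real.exp (-(Real.exp (-x) / r !)) := by
  have hr : (0 : ℝ) < (r ! : ℝ)⁻¹ := by positivity
  rw [gumbelMeasure, map_measureReal_apply (by fun_prop) measurableSet_Iic, div_eq_inv_mul,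
    ← measureReal_expMeasure_Ioi hr (by positivity), measureReal_congr Ioi_ae_eq_Ici]
  refine measureReal_congr ?_
  filter_upwards [ae_expMeasure_pos hr] with u hu
  refine propext ?_
  change -Real.log u ≤ x ↔ Real.exp (-x) ≤ u
  rw [neg_le, Real.le_log_iff_exp_le hu]

/-- Comparing two independent Gumbel variables amounts to a race between two independent
exponential variables. -/
theorem measureReal_gumbelMeasure_prod_gumbelMeasure_sub_lt (r₁ r₂ : ℕ) (x : ℝ) :
    ((gumbelMeasure r₁).prod (gumbelMeasure r₂)).real {p | p.2 - p.1 < x} =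
      r₂ ! / (r₂ ! + r₁ ! * Real.exp (-x)) := by
  have h₁ : (0 : ℝ) < (r₁ ! : ℝ)⁻¹ := by positivity
  have h₂ : (0 : ℝ) < (r₂ ! : ℝ)⁻¹ := by positivity
  have := isProbabilityMeasure_expMeasure h₁
  have := isProbabilityMeasure_expMeasure h₂
  have hrace : Prod.map (fun u => -Real.log u) (fun u => -Real.log u) ⁻¹' {p | p.2 - p.1 < x}
      =ᵐ[(expMeasure (r₁ ! : ℝ)⁻¹).prod (expMeasure (r₂ ! : ℝ)⁻¹)]
      {p | Real.exp (-x) * p.1 < p.2} := by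
    filter_upwards [Measure.quasiMeasurePreserving_fst.ae (ae_expMeasure_pos h₁),
      Measure.quasiMeasurePreserving_snd.ae (ae_expMeasure_pos h₂)] with p hp₁ hp₂
    refine propext ?_
    change -Real.log p.2 - -Real.log p.1 < x ↔ Real.exp (-x) * p.1 < p.2
    rw [← Real.log_lt_log_iff (by positivity) hp₂, Real.log_mul (by positivity) hp₁.ne',
      Real.log_exp]
    constructor <;> intro h <;> linarith
  rw [gumbelMeasure, gumbelMeasure, Measure.map_prod_map _ _ (by fun_prop) (by fun_prop),
    map_measureReal_apply (by fun_prop) (measurableSet_lt (by fun_prop) (by fun_prop)),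
    measureReal_congr hrace,
    measureReal_expMeasure_prod_expMeasure_mul_lt h₁ h₂ (by positivity)]
  field_simp

end Gumbel

section LimitLaw

variable {ι : Type*} {l : Filter ι} [l.IsCountablyGenerated] {Ω α : ι → Type*}
  [∀ i, MeasurableSpace (Ω i)] [∀ i, MeasurableSpace (α i)]
  [∀ i, MeasurableSingletonClass (α i)] [∀ i, Fintype (α i)] {P : ∀ i, Measure (Ω i)}
  [∀ i, IsProbabilityMeasure (P i)] {C : ∀ i, ℕ → Ω i → α i}

theorem tendstoInDistribution_normalizedTime
    (hC : ∀ i, IsCouponSequence (C i) (fun _ => (Fintype.card (α i) : ℝ≥0)⁻¹) (P i))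
    (hα : Tendsto (fun i => Fintype.card (α i)) l atTop) {r₁ r₂ : ℕ} (hr : r₁ ≠ r₂) :
    TendstoInDistribution (fun i ω => (normalizedTime (fun k => C i k ω) r₁,
      normalizedTime (fun k => C i k ω) r₂)) l id P
      ((gumbelMeasure r₁).prod (gumbelMeasure r₂)) := by
  have hmeas : ∀ i, Measurable fun ω => (normalizedTime (fun k => C i k ω) r₁,
      normalizedTime (fun k => C i k ω) r₂) := fun i =>
    (measurable_normalizedTime (hC i).measurable r₁).prodMk
      (measurable_normalizedTime (hC i).measurable r₂)
  refine ⟨fun i => (hmeas i).aemeasurable, aemeasurable_id,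
    tendsto_probabilityMeasure_of_tendsto_Iic_prod_Iic fun x y => ?_⟩
  simp only [ProbabilityMeasure.coe_mk, Measure.map_id, measureReal_prod_prod,
    measureReal_gumbelMeasure_Iic, ← Real.exp_add, ← neg_add,
    map_measureReal_apply (hmeas _) (measurableSet_Iic.prod measurableSet_Iic)]
  exact tendsto_measureReal_normalizedTime_le hC hα hr x y

theorem corollary1_general
    (hC : ∀ i, IsCouponSequence (C i) (fun _ => (Fintype.card (α i) : ℝ≥0)⁻¹) (P i))
    (hα : Tendsto (fun i => Fintype.card (α i)) l atTop) {r₁ r₂ : ℕ} (hr : r₁ ≠ r₂)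
    {Ω' : Type*} [MeasurableSpace Ω'] {Q : Measure Ω'} [IsProbabilityMeasure Q] {L : Ω' → ℝ}
    (hL_meas : AEMeasurable L Q)
    (hL : ∀ x, Q.real {ω | L ω < x} = r₂ ! / (r₂ ! + r₁ ! * Real.exp (-x))) :
    TendstoInDistribution (fun i ω =>
      interCompletionTime (fun k => C i k ω) r₁ r₂ / Fintype.card (α i) -
        ((r₂ : ℝ) - r₁) * Real.log (Real.log (Fintype.card (α i)))) l L P Q := by
  have hsub : Continuous fun p : ℝ × ℝ => p.2 - p.1 := by fun_prop
  have hlaw : IdentDistrib (fun p : ℝ × ℝ => p.2 - p.1) L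
      ((gumbelMeasure r₁).prod (gumbelMeasure r₂)) Q := by
    refine ⟨hsub.aemeasurable, hL_meas, ?_⟩
    have := Measure.isProbabilityMeasure_map hL_meas
    have := Measure.isProbabilityMeasure_map
      (μ := (gumbelMeasure r₁).prod (gumbelMeasure r₂)) hsub.aemeasurable
    refine ext_of_measureReal_Iio fun x => ?_
    rw [map_measureReal_apply hsub.measurable measurableSet_Iio,
      map_measureReal_apply_of_aemeasurable hL_meas measurableSet_Iio]
    exact (measureReal_gumbelMeasure_prod_gumbelMeasure_sub_lt r₁ r₂ x).trans (hL x).symm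
  refine tendstoInDistribution_of_identDistrib_limit
    (((tendstoInDistribution_normalizedTime hC hα hr).continuous_comp hsub).congr
      (fun i => .of_forall fun ω => ?_) .rfl) hlaw
  simp only [interCompletionTime, normalizedTime, Function.comp_apply]
  ring

end LimitLaw

theorem corollary1 {Ω : ℕ+ → Type*} [∀ n, MeasurableSpace (Ω n)]
    (P : ∀ n, Measure (Ω n)) [∀ n, IsProbabilityMeasure (P n)]
    (C : ∀ n : ℕ+, ℕ → Ω n → Fin n)
    (hC_meas : ∀ n k, Measurable (C n k))
    (hC_indep : ∀ n, iIndepFun (C n) (P n))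
    (hC_unif : ∀ (n : ℕ+) (k : ℕ) (i : Fin n), (P n).real {ω | C n k ω = i} = 1 / (n : ℝ))
    (r₁ r₂ : ℕ) (hr : r₁ < r₂)
    {Ω' : Type*} [MeasurableSpace Ω'] (Q : Measure Ω') [IsProbabilityMeasure Q]
    (L : Ω' → ℝ) (hL_meas : Measurable L)
    (hL : ∀ x : ℝ, Q.real {ω | L ω < x} =
      (r₂.factorial : ℝ) / ((r₂.factorial : ℝ) + (r₁.factorial : ℝ) * Real.exp (-x))) :
    TendstoInDistribution
      (fun (n : ℕ+) (ω : Ω n) =>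
        interCompletionTime (fun k => C n k ω) r₁ r₂ / (n : ℝ) -
          ((r₂ : ℝ) - (r₁ : ℝ)) * Real.log (Real.log (n : ℝ)))
      atTop L P Q := by
  have h := corollary1_general (fun n => ⟨hC_meas n, hC_indep n, by simpa using hC_unif n⟩)
    (by simpa using tendsto_PNat_val_atTop_atTop) hr.ne hL_meas.aemeasurable hL
  simpa only [Fintype.card_fin] using h
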